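/- Let $F(X)$ be the free group on a countably infinite set of variables $X=\{x_1,x_2,\dots\}$; its elements are called words. For a word $w=w(x_1,\dots,x_n)$ and a group $G$, let $w[G]=\{w(g_1,\dots,g_n) : g_1,\dots,g_n\in G\}$ be the set of values of $w$ in $G$. The word $w$ is called proper if there exist groups $G$ and $K$ with $w[G]\neq\{1\}$ and $w[K]\neq K$. The rational subsets of a monoid $M$ form the smallest family of subsets of $M$ that contains all finite subsets and is closed under union, product $L_1L_2=\{ab : a\in L_1,\ b\in L_2\}$, and passage from $L$ to the submonoid $L^{\ast}$ generated by $L$. Let $C$ and $D$ be finitely generated groups whose abelianizations are infinite, and let $H=C\ast D$ be their free product. Then for every proper word $w$ the set $w[H]$ is not rational in $H$. Moreover, $H$ admits a surjective homomorphism onto the free group $F_2\cong\mathbb Z\ast\mathbb Z$ of rank $2$. -/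

import Mathlib

open scoped Pointwise

universe u v

/-- Rational subsets of a monoid: the smallest family of subsets containing all finite subsets
and closed under union, product, and passage to the generated submonoid. -/
inductive IsRationalSubset {M : Type u} [Monoid M] : Set M → Prop
  | finite (S : Set M) (hS : S.Finite) : IsRationalSubset S
  | union (S T : Set M) (hS : IsRationalSubset S) (hT : IsRationalSubset T) :
      IsRationalSubset (S ∪ T)
  | mul (S T : Set M) (hS : IsRationalSubset S) (hT : IsRationalSubset T) :
      IsRationalSubset (S * T)
  | star (S : Set M) (hS : IsRationalSubset S) :
      IsRationalSubset (Submonoid.closure S : Set M)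

/-- The verbal set `w[G]` of all values in `G` of a group word `w` in the variables
`x₀, x₁, x₂, …` (an element of the free group on countably many generators). -/
def verbalSet (w : FreeGroup ℕ) (G : Type u) [Group G] : Set G :=
  Set.range fun g : ℕ → G => FreeGroup.lift g w

/-- A word `w` is proper if `w[G] ≠ 1` for some group `G` and `w[K] ≠ K` for some group `K`.
The groups may live in arbitrary universes. -/
def IsProperWord (w : FreeGroup ℕ) : Prop :=
  (∃ (G : Type u) (_ : Group G), verbalSet w G ≠ {1}) ∧
    ∃ (K : Type v) (_ : Group K), verbalSet w K ≠ Set.univ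

namespace Monoid.CoprodI

section NormalForm

variable {ι : Type*} {G : ι → Type*} [∀ i, Group (G i)] [DecidableEq ι] [∀ i, DecidableEq (G i)]

/-- The first syllable of the normal form of `x` if it lies in `G i`, and `1` otherwise. -/
def headPart (i : ι) (x : CoprodI G) : G i :=
  (Word.equivPair i (Word.equiv x)).head

@[simp]
theorem headPart_one (i : ι) : headPart i (1 : CoprodI G) = 1 := by
  have : Word.equiv (1 : CoprodI G) = Word.empty := by simp [Word.equiv]
  simp [headPart, this, Word.equivPair_head]

theorem wordEquiv_mul (x y : CoprodI G) : Word.equiv (x * y) = x • Word.equiv y := by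
  simp [Word.equiv, mul_smul]

@[simp]
theorem headPart_of_mul (i : ι) (m : G i) (x : CoprodI G) :
    headPart i (of m * x) = m * headPart i x := by
  simp [headPart, wordEquiv_mul, Word.equivPair_smul_same]

@[simp]
theorem headPart_of (i : ι) (m : G i) : headPart i (of m : CoprodI G) = m := by
  simpa using headPart_of_mul i m 1

theorem headPart_eq_one_of_ne {i k : ι} (hik : i ≠ k) {x : CoprodI G} (h : headPart k x ≠ 1) :
    headPart i x = 1 := by
  unfold headPart at *
  rw [Word.equivPair_head] at *
  by_contra hi
  split_ifs at * with h1 h2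
  obtain ⟨_, e1⟩ := h1
  obtain ⟨_, e2⟩ := h2
  all_goals first | exact hik (e2.symm.trans e1) | exact hik (e1.symm.trans e2) | simp_all

theorem headPart_of_of_ne {i k : ι} (hik : i ≠ k) (m : G k) :
    headPart i (of m : CoprodI G) = 1 := by
  by_cases hm : m = 1
  · simp [hm]
  · exact headPart_eq_one_of_ne hik (by simpa using hm)

theorem fstIdx_ne_iff_headPart {i : ι} {w : Word G} :
    w.fstIdx ≠ some i ↔ headPart i w.prod = 1 := by
  have : Word.equiv w.prod = w := Word.equiv.apply_symm_apply w
  unfold headPart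
  rw [this]
  constructor
  · intro h
    rw [Word.equivPair_eq_of_fstIdx_ne h]
  · intro h
    have := (Word.equivPair i).symm_apply_apply w
    rw [Word.equivPair_symm, Word.rcons, dif_pos h] at this
    rw [← this]
    exact (Word.equivPair i w).fstIdx_ne

/-- Induction on the number of syllables of the normal form. -/
theorem syllable_induction {p : CoprodI G → Prop} (one : p 1)
    (of_mul : ∀ k (m : G k) x, m ≠ 1 → headPart k x = 1 → p x → p (of m * x)) (x : CoprodI G) :
    p x := by
  obtain ⟨w, rfl⟩ := Word.equiv.symm.surjective x
  change p w.prod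
  induction w using Word.consRecOn with
  | empty => exact one
  | cons i m w h1 h2 ih =>
    rw [Word.prod_cons]
    exact of_mul i m _ h2 (fstIdx_ne_iff_headPart.1 h1) ih

variable {A : Type*} [AddCommGroup A]

/-- The sum of the values of `φ` over the syllables of the normal form of `x`. -/
def syllableSum (φ : ∀ i, G i → A) (x : CoprodI G) : A :=
  ((Word.equiv x).toList.map fun s => φ s.1 s.2).sum

variable {φ : ∀ i, G i → A}

@[simp]
theorem syllableSum_one : syllableSum φ (1 : CoprodI G) = 0 := by
  have : Word.equiv (1 : CoprodI G) = Word.empty := by simp [Word.equiv]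
  simp [syllableSum, this]

theorem syllableSum_of_mul (h1 : ∀ i, φ i 1 = 0) {k : ι} (m : G k) {x : CoprodI G}
    (hx : headPart k x = 1) : syllableSum φ (of m * x) = φ k m + syllableSum φ x := by
  by_cases hm : m = 1
  · simp [hm, h1]
  · obtain ⟨w, rfl⟩ := Word.equiv.symm.surjective x
    have hw : Word.equiv (Word.equiv.symm w) = w := Word.equiv.apply_symm_apply w
    have := Word.cons_eq_smul (h1 := fstIdx_ne_iff_headPart.2 hx) (h2 := hm)
    rw [syllableSum, syllableSum, wordEquiv_mul, hw, ← this]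
    simp

theorem syllableSum_of_mul' (h1 : ∀ i, φ i 1 = 0) {k : ι} (m : G k) (x : CoprodI G) :
    syllableSum φ (of m * x) =
      φ k (m * headPart k x) - φ k (headPart k x) + syllableSum φ x := by
  set t := headPart k x with ht
  have hy : headPart k (of t⁻¹ * x) = 1 := by rw [headPart_of_mul, ← ht, inv_mul_cancel]
  have hx : x = of t * (of t⁻¹ * x) := by simp
  conv_lhs => rw [hx, ← mul_assoc, ← map_mul]
  conv_rhs => rw [hx]
  rw [syllableSum_of_mul h1 _ hy, syllableSum_of_mul h1 _ hy]
  abel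

/-- If `x * y` and `x` have different heads, then the cancellation in `x * y` reaches the first
syllable of `x`, and the defect of `syllableSum φ` at `(x, y)` is located there. -/
theorem syllableSum_mul_of_headPart_ne (h1 : ∀ i, φ i 1 = 0) (hinv : ∀ i m, φ i m⁻¹ = -φ i m)
    (x y : CoprodI G) (i : ι) (h : headPart i (x * y) ≠ headPart i x) :
    syllableSum φ (x * y) = syllableSum φ x + syllableSum φ y + φ i (headPart i (x * y))
      - φ i (headPart i x) - φ i ((headPart i x)⁻¹ * headPart i (x * y)) := by
  induction x using syllable_induction generalizing i with
  | one => simp [h1]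
  | of_mul k m x hm hx ih =>
    rw [mul_assoc] at h ⊢
    by_cases hik : i = k
    · subst hik
      have ht : headPart i (x * y) ≠ headPart i x := by simpa [hx] using h
      have := ih i ht
      rw [syllableSum_of_mul' h1, this, syllableSum_of_mul h1 m hx]
      simp only [headPart_of_mul, hx, h1, mul_one, inv_one, one_mul, inv_mul_cancel_left]
      abel
    · have hi : headPart i (of m * x) = 1 :=
        headPart_eq_one_of_ne hik (by simpa [hx] using hm)
      rw [hi] at h ⊢
      have hk : headPart k (of m * (x * y)) = 1 := headPart_eq_one_of_ne (Ne.symm hik) h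
      rw [headPart_of_mul] at hk
      have hk' : headPart k (x * y) = m⁻¹ := eq_inv_of_mul_eq_one_right hk
      have := ih k (by simpa [hk', hx] using hm)
      rw [syllableSum_of_mul' h1, this, syllableSum_of_mul h1 m hx]
      simp [hk', hx, h1, hinv]
      abel

/-- The defect of `syllableSum φ` is a defect of one of the maps `φ i`. -/
theorem exists_syllableSum_mul (h1 : ∀ i, φ i 1 = 0) (hinv : ∀ i m, φ i m⁻¹ = -φ i m)
    (x y : CoprodI G) :
    syllableSum φ (x * y) = syllableSum φ x + syllableSum φ y ∨
    ∃ i s t, syllableSum φ (x * y) =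
      syllableSum φ x + syllableSum φ y + φ i (s * t) - φ i s - φ i t := by
  induction x using syllable_induction with
  | one => simp
  | of_mul k m x hm hx ih =>
    by_cases hk : headPart k (x * y) = 1
    · rw [mul_assoc, syllableSum_of_mul h1 m hx, syllableSum_of_mul h1 m hk]
      rcases ih with ih | ⟨i, s, t, ih⟩
      · left
        rw [ih, add_assoc]
      · refine Or.inr ⟨i, s, t, ?_⟩
        rw [ih]
        abel
    · right
      have := syllableSum_mul_of_headPart_ne h1 hinv (of m * x) y k
        (by simpa [mul_assoc, hx] using hk)
      exact ⟨k, headPart k (of m * x), _, by rw [this, mul_inv_cancel_left]⟩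

/-- Right multiplication by an element of a factor changes the head of `x` only if `x` lies in a
factor. -/
theorem headPart_mul_of (x : CoprodI G) (i : ι) {j : ι} (m : G j) :
    headPart i (x * of m) = headPart i x ∨ ∃ s : G i, x = of s := by
  induction x using syllable_induction generalizing i with
  | one => exact Or.inr ⟨1, by simp⟩
  | of_mul k s x hs hx ih =>
    by_cases hik : i = k
    · subst hik
      rw [mul_assoc, headPart_of_mul, headPart_of_mul]
      rcases ih i with h | ⟨t, rfl⟩
      · exact Or.inl (by rw [h])
      · exact Or.inr ⟨s * t, by simp⟩
    · left
      rw [headPart_eq_one_of_ne hik (x := of s * x) (by simpa [hx] using hs)]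
      rcases ih k with h | ⟨t, rfl⟩
      · exact headPart_eq_one_of_ne hik (by simpa [mul_assoc, h, hx] using hs)
      · obtain rfl : t = 1 := by simpa using hx
        rw [map_one, mul_one]
        by_cases hjk : j = k
        · subst hjk
          rw [← map_mul]
          exact headPart_of_of_ne hik _
        · refine headPart_eq_one_of_ne hik ?_
          simpa [headPart_of_of_ne (Ne.symm hjk)] using hs

end NormalForm

end Monoid.CoprodI

section Rational

variable {M : Type*} {N : Type*}

theorem IsRationalSubset.image [Monoid M] [Monoid N] (f : M →* N) {R : Set M}
    (hR : IsRationalSubset R) : IsRationalSubset (f '' R) := by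
  induction hR with
  | finite S hS => exact .finite _ (hS.image f)
  | union S T _ _ ihS ihT =>
    rw [Set.image_union]
    exact .union _ _ ihS ihT
  | mul S T _ _ ihS ihT =>
    rw [Set.image_mul]
    exact .mul _ _ ihS ihT
  | star S _ ih =>
    have : f '' (Submonoid.closure S : Set M) = (Submonoid.closure (f '' S) : Set N) := by
      rw [← MonoidHom.map_mclosure, Submonoid.coe_map]
    rw [this]
    exact .star _ ih

variable {Q : Type*} [Group Q]

/-- Let `E` be a subset of a group that is almost invariant under right translations. The
factorizations `r = g * (g⁻¹ * r)` of elements `r` of a rational set `R`, at points `g` such that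
`g • E` separates `1` from `r`, are covered by finitely many products of sets contained in `R`. -/
theorem IsRationalSubset.exists_finite_cuts {E : Set Q}
    (hE : ∀ r : Q, {x | ¬(x ∈ E ↔ x * r ∈ E)}.Finite) {R : Set Q} (hR : IsRationalSubset R) :
    ∃ F : Set (Set Q × Set Q), F.Finite ∧ (∀ P ∈ F, P.1 * P.2 ⊆ R) ∧
      ∀ r ∈ R, ∀ g, ¬(g⁻¹ ∈ E ↔ g⁻¹ * r ∈ E) → ∃ P ∈ F, g ∈ P.1 ∧ g⁻¹ * r ∈ P.2 := by
  induction hR with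
  | finite S hS =>
    refine ⟨⋃ r ∈ S, (fun x => ({x⁻¹}, {x * r})) '' {x | ¬(x ∈ E ↔ x * r ∈ E)},
      hS.biUnion fun r _ => (hE r).image _, ?_, ?_⟩
    · intro P hP
      simp only [Set.mem_iUnion, Set.mem_image] at hP
      obtain ⟨r, hr, x, -, rfl⟩ := hP
      simpa using hr
    · intro r hr g hg
      exact ⟨_, Set.mem_biUnion hr ⟨g⁻¹, hg, rfl⟩, by simp, by simp⟩
  | union S T _ _ ihS ihT =>
    obtain ⟨F, hF, hFS, hFc⟩ := ihS
    obtain ⟨F', hF', hFT, hFc'⟩ := ihT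
    refine ⟨F ∪ F', hF.union hF', ?_, ?_⟩
    · rintro P (hP | hP)
      · exact (hFS P hP).trans Set.subset_union_left
      · exact (hFT P hP).trans Set.subset_union_right
    · rintro r (hr | hr) g hg
      · obtain ⟨P, hP, h⟩ := hFc r hr g hg
        exact ⟨P, .inl hP, h⟩
      · obtain ⟨P, hP, h⟩ := hFc' r hr g hg
        exact ⟨P, .inr hP, h⟩
  | mul S T _ _ ihS ihT =>
    obtain ⟨F, hF, hFS, hFc⟩ := ihS
    obtain ⟨F', hF', hFT, hFc'⟩ := ihT
    refine ⟨(fun P => (P.1, P.2 * T)) '' F ∪ (fun P => (S * P.1, P.2)) '' F',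
      (hF.image _).union (hF'.image _), ?_, ?_⟩
    · rintro _ (⟨P, hP, rfl⟩ | ⟨P, hP, rfl⟩)
      · rw [← mul_assoc]
        exact Set.mul_subset_mul_right (hFS P hP)
      · rw [mul_assoc]
        exact Set.mul_subset_mul_left (hFT P hP)
    · rintro _ ⟨r, hr, s, hs, rfl⟩ g hg
      by_cases h : g⁻¹ ∈ E ↔ g⁻¹ * r ∈ E
      · obtain ⟨P, hP, h1, h2⟩ := hFc' s hs (r⁻¹ * g) (by
          simpa [mul_assoc, h] using hg)
        refine ⟨_, .inr ⟨P, hP, rfl⟩, ⟨r, hr, _, h1, by simp⟩, ?_⟩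
        simpa [mul_assoc] using h2
      · obtain ⟨P, hP, h1, h2⟩ := hFc r hr g h
        exact ⟨_, .inl ⟨P, hP, rfl⟩, h1, _, h2, s, hs, by simp [mul_assoc]⟩
  | star S _ ih =>
    obtain ⟨F, hF, hFS, hFc⟩ := ih
    set K := Submonoid.closure S
    refine ⟨(fun P => ((K : Set Q) * P.1, P.2 * (K : Set Q))) '' F, hF.image _, ?_, ?_⟩
    · rintro _ ⟨P, hP, rfl⟩ _ ⟨_, ⟨k, hk, a, ha, rfl⟩, _, ⟨b, hb, l, hl, rfl⟩, rfl⟩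
      have : a * b ∈ K := Submonoid.subset_closure (hFS P hP ⟨a, ha, b, hb, rfl⟩)
      have := K.mul_mem hk (K.mul_mem this hl)
      simpa [mul_assoc] using this
    · intro r hr
      induction hr using Submonoid.closure_induction_left with
      | one => simp
      | mul_left r hr s hs ih' =>
        intro g hg
        by_cases h : g⁻¹ ∈ E ↔ g⁻¹ * r ∈ E
        · obtain ⟨_, ⟨P, hP, rfl⟩, ⟨k, hk, a, ha, hka⟩, h2⟩ := ih' (r⁻¹ * g) (by
            simpa [mul_assoc, h] using hg)
          refine ⟨_, ⟨P, hP, rfl⟩,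
            ⟨r * k, K.mul_mem (Submonoid.subset_closure hr) hk, a, ha, ?_⟩, ?_⟩
          · simp only at hka ⊢
            rw [mul_assoc, hka, mul_inv_cancel_left]
          · simpa [mul_assoc] using h2
        · obtain ⟨P, hP, h1, h2⟩ := hFc r hr g h
          exact ⟨_, ⟨P, hP, rfl⟩, ⟨1, K.one_mem, g, h1, by simp⟩,
            ⟨_, h2, s, hs, by simp [mul_assoc]⟩⟩

end Rational

open Monoid

/-- The free product of two infinite cyclic groups. -/
abbrev IntFreeProd : Type := CoprodI fun _ : Bool => Multiplicative ℤ

namespace IntFreeProd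

/-- Powers of the standard generator of the factor with index `i`. -/
def gpow (i : Bool) (n : ℤ) : IntFreeProd :=
  CoprodI.of (M := fun _ : Bool => Multiplicative ℤ) (i := i) (Multiplicative.ofAdd n)

/-- The exponent of the first syllable of the normal form if its factor has index `i`, or `0`. -/
def headExp (i : Bool) (x : IntFreeProd) : ℤ :=
  (CoprodI.headPart i x).toAdd

theorem gpow_add (i : Bool) (m n : ℤ) : gpow i (m + n) = gpow i m * gpow i n := by
  simp [gpow]

@[simp]
theorem gpow_zero (i : Bool) : gpow i 0 = 1 := by
  simp [gpow]

@[simp]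
theorem inv_gpow (i : Bool) (n : ℤ) : (gpow i n)⁻¹ = gpow i (-n) := by
  simp [gpow]

theorem gpow_induction {p : IntFreeProd → Prop} (x : IntFreeProd) (one : p 1)
    (gpow : ∀ i n, p (gpow i n)) (mul : ∀ x y, p x → p y → p (x * y)) : p x := by
  induction x using CoprodI.induction_on with
  | one => exact one
  | of i m => exact gpow i m.toAdd
  | mul x y hx hy => exact mul x y hx hy

@[simp]
theorem headExp_one (i : Bool) : headExp i 1 = 0 := by
  simp [headExp]

@[simp]
theorem headExp_gpow_mul (i : Bool) (n : ℤ) (x : IntFreeProd) :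
    headExp i (gpow i n * x) = n + headExp i x := by
  simp [headExp, gpow]

@[simp]
theorem headExp_gpow (i : Bool) (n : ℤ) : headExp i (gpow i n) = n := by
  simp [headExp, gpow]

theorem headExp_eq_zero_of_ne {i k : Bool} (hik : i ≠ k) {x : IntFreeProd}
    (h : headExp k x ≠ 0) : headExp i x = 0 := by
  have := CoprodI.headPart_eq_one_of_ne hik (x := x) (by
    intro h'
    simp [headExp, h'] at h)
  simp [headExp, this]

theorem headExp_gpow_mul_of_ne {i k : Bool} (hik : i ≠ k) {n : ℤ} (hn : n ≠ 0) {x : IntFreeProd}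
    (h : headExp k x = 0) : headExp i (gpow k n * x) = 0 :=
  headExp_eq_zero_of_ne hik (by simpa [h] using hn)

theorem headExp_gpow_of_ne {i k : Bool} (hik : i ≠ k) (n : ℤ) : headExp i (gpow k n) = 0 := by
  simpa [headExp, gpow] using
    CoprodI.headPart_of_of_ne (G := fun _ : Bool => Multiplicative ℤ) hik (Multiplicative.ofAdd n)

theorem headExp_mul_gpow (x : IntFreeProd) (i j : Bool) (n : ℤ) :
    headExp i (x * gpow j n) = headExp i x ∨ ∃ s, x = gpow i s := by
  rcases CoprodI.headPart_mul_of x i (j := j) (Multiplicative.ofAdd n) with h | ⟨s, h⟩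
  · exact Or.inl (by simpa [headExp, gpow] using h)
  · exact Or.inr ⟨s.toAdd, h⟩

theorem finite_setOf_headExp_pos_mul (i : Bool) (r : IntFreeProd) :
    {x | ¬(x ∈ {x | 0 < headExp i x} ↔ x * r ∈ {x | 0 < headExp i x})}.Finite := by
  induction r using gpow_induction with
  | one => simp
  | gpow j n =>
    refine ((Set.finite_Icc (-|n|) |n|).image (gpow i)).subset fun x hx => ?_
    rcases headExp_mul_gpow x i j n with h | ⟨s, rfl⟩
    · simp [h] at hx
    · by_cases hij : i = j
      · subst hij
        refine ⟨s, ?_, rfl⟩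
        simp only [Set.mem_ofPred_eq, headExp_gpow, ← gpow_add] at hx
        rw [Set.mem_Icc]
        rcases abs_cases n with h | h <;> omega
      · simp [headExp_gpow_of_ne hij] at hx
  | mul r s hr hs =>
    refine (hr.union (hs.preimage (f := (· * r)) (mul_left_injective r).injOn)).subset
      fun x hx => ?_
    simp only [Set.mem_union, Set.mem_preimage, Set.mem_ofPred_eq, ← mul_assoc] at hx ⊢
    tauto

/-- Pumping lemma: a long power occurring in an element of a rational set can be lengthened. -/
theorem exists_pump {R : Set IntFreeProd} (hR : IsRationalSubset R) (i : Bool) :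
    ∃ L : ℕ, 0 < L ∧ ∀ (x y : IntFreeProd) (n : ℤ), L ≤ n → headExp i x⁻¹ = 0 → headExp i y = 0 →
      x * (gpow i n * y) ∈ R → ∃ n', n < n' ∧ n' < n + L ∧ x * (gpow i n' * y) ∈ R := by
  obtain ⟨F, hF, hFR, hFc⟩ := hR.exists_finite_cuts (finite_setOf_headExp_pos_mul i)
  refine ⟨hF.toFinset.card + 1, Nat.succ_pos _, fun x y n hn hx hy hmem => ?_⟩
  have key : ∀ j ∈ Finset.range (hF.toFinset.card + 1), ∃ P ∈ hF.toFinset,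
      x * gpow i j ∈ P.1 ∧ gpow i (n - j) * y ∈ P.2 := by
    intro j hj
    rw [Finset.mem_range] at hj
    have e : (x * gpow i j)⁻¹ * (x * (gpow i n * y)) = gpow i (n - j) * y := by
      rw [sub_eq_neg_add, gpow_add, ← inv_gpow]
      group
    obtain ⟨P, hP, h⟩ := hFc _ hmem (x * gpow i j) (by
      rw [e]
      simp only [mul_inv_rev, inv_gpow, Set.mem_ofPred_eq, headExp_gpow_mul, hx, hy]
      omega)
    rw [e] at h
    exact ⟨P, by simpa using hP, h⟩
  choose! P hPF hP1 hP2 using key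
  obtain ⟨j, hj, k, hk, hjk, e⟩ := Finset.exists_ne_map_eq_of_card_lt_of_maps_to
    (by simp) hPF
  wlog hlt : j < k generalizing j k
  · exact this k hk j hj hjk.symm e.symm (by omega)
  refine ⟨n + k - j, by omega, ?_, ?_⟩
  · rw [Finset.mem_range] at hk
    push_cast
    omega
  · have := hFR _ (by simpa using hPF j hj)
      (Set.mul_mem_mul (e ▸ hP1 k hk : x * gpow i k ∈ (P j).1) (hP2 j hj))
    rwa [mul_assoc, ← mul_assoc (gpow i k), ← gpow_add,
      show (k : ℤ) + (n - j) = n + k - j by ring] at this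

end IntFreeProd

section Words

/-- The value of a word in `ℤ`, as a homomorphism in the tuple of its arguments. -/
def FreeGroup.intValue (w : FreeGroup ℕ) : (ℕ → ℤ) →+ ℤ :=
  AddMonoidHom.mk' (fun n => (FreeGroup.lift (fun i => Multiplicative.ofAdd (n i)) w).toAdd)
    fun m n => by
      induction w using FreeGroup.induction_on with
      | C1 => simp
      | of x => simp
      | inv_of x h => simp [add_comm]
      | mul x y hx hy =>
        simp only [_root_.map_mul (FreeGroup.lift _), toAdd_mul, hx, hy]
        abel

theorem FreeGroup.intValue_apply (w : FreeGroup ℕ) (n : ℕ → ℤ) :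
    w.intValue n = (FreeGroup.lift (fun i => Multiplicative.ofAdd (n i)) w).toAdd :=
  rfl

theorem FreeGroup.lift_zpow {K : Type*} [Group K] (w : FreeGroup ℕ) (g : K) (n : ℕ → ℤ) :
    FreeGroup.lift (fun i => g ^ n i) w = g ^ w.intValue n := by
  have : FreeGroup.lift (fun i => g ^ n i) =
      (zpowersHom K g).comp (FreeGroup.lift fun i => Multiplicative.ofAdd (n i)) := by
    ext i
    simp
  rw [this]
  simp [FreeGroup.intValue_apply]

theorem IsProperWord.ne_one {w : FreeGroup ℕ} (hw : IsProperWord.{u, v} w) : w ≠ 1 := by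
  rintro rfl
  obtain ⟨⟨G, _, hG⟩, -⟩ := hw
  exact hG (by simp [verbalSet])

/-- The values of a proper word in `ℤ` have a common divisor different from `1`. -/
theorem IsProperWord.exists_dvd_intValue {w : FreeGroup ℕ} (hw : IsProperWord.{u, v} w) :
    ∃ q : ℤ, ¬IsUnit q ∧ ∀ n, q ∣ w.intValue n := by
  obtain ⟨-, K, _, hK⟩ := hw
  obtain ⟨q, hq⟩ := Int.subgroup_cyclic w.intValue.range
  rw [← AddSubgroup.zmultiples_eq_closure] at hq
  refine ⟨q, fun hu => hK ?_, fun n => ?_⟩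
  · have : (1 : ℤ) ∈ w.intValue.range := by
      rw [hq, Int.mem_zmultiples_iff]
      exact hu.dvd
    obtain ⟨n, hn⟩ := this
    refine Set.eq_univ_of_forall fun g => ⟨fun i => g ^ n i, ?_⟩
    change FreeGroup.lift (fun i => g ^ n i) w = g
    rw [FreeGroup.lift_zpow, hn, zpow_one]
  · rw [← Int.mem_zmultiples_iff, ← hq]
    exact ⟨n, rfl⟩

theorem verbalSet_image {G H : Type*} [Group G] [Group H] (w : FreeGroup ℕ) {f : G →* H}
    (hf : Function.Surjective f) : f '' verbalSet w G = verbalSet w H := by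
  have key (g : ℕ → G) : f (FreeGroup.lift g w) = FreeGroup.lift (fun i => f (g i)) w := by
    have : f.comp (FreeGroup.lift g) = FreeGroup.lift (fun i => f (g i)) := by
      ext i
      simp
    rw [← this]
    rfl
  ext x
  constructor
  · rintro ⟨_, ⟨g, rfl⟩, rfl⟩
    exact ⟨_, (key g).symm⟩
  · rintro ⟨g, rfl⟩
    choose g' hg' using fun i => hf (g i)
    exact ⟨_, ⟨g', rfl⟩, by simp [key, hg']⟩

theorem conj_mem_verbalSet {G : Type*} [Group G] {w : FreeGroup ℕ} {v : G}
    (hv : v ∈ verbalSet w G) (h : G) : h * (v * h⁻¹) ∈ verbalSet w G := by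
  rw [← verbalSet_image w (MulAut.conj h).surjective (f := (MulAut.conj h).toMonoidHom)]
  exact ⟨v, hv, by simp [mul_assoc]⟩

end Words

section UniformDefect

variable {Q J : Type*} [Group Q]

/-- Every element is mapped to a homomorphism value by all but a bounded number of members of
the family `c`, where the bound depends on the word only. -/
theorem exists_card_lift_eq_intValue [DecidableEq J] {c : J → Q → ℤ} {B : ℕ}
    (hc : ∀ x y, ∃ T : Finset J, T.card ≤ B ∧ ∀ j ∉ T, c j (x * y) = c j x + c j y)
    (w : FreeGroup ℕ) :
    ∃ N : ℕ, ∀ g : ℕ → Q, ∃ T : Finset J, T.card ≤ N ∧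
      ∀ j ∉ T, c j (FreeGroup.lift g w) = w.intValue fun i => c j (g i) := by
  have h1 : ∃ T : Finset J, T.card ≤ B ∧ ∀ j ∉ T, c j 1 = 0 := by
    obtain ⟨T, hT, h⟩ := hc 1 1
    exact ⟨T, hT, fun j hj => by simpa using h j hj⟩
  induction w using FreeGroup.induction_on with
  | C1 =>
    obtain ⟨T, hT, h⟩ := h1
    exact ⟨B, fun g => ⟨T, hT, fun j hj => by simp [h j hj, FreeGroup.intValue_apply]⟩⟩
  | of x => exact ⟨0, fun g => ⟨∅, by simp, fun j _ => by simp [FreeGroup.intValue_apply]⟩⟩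
  | inv_of x _ =>
    obtain ⟨T, hT, h⟩ := h1
    refine ⟨B + B, fun g => ?_⟩
    obtain ⟨T', hT', h'⟩ := hc (g x) (g x)⁻¹
    refine ⟨T ∪ T', (Finset.card_union_le _ _).trans (by omega), fun j hj => ?_⟩
    rw [Finset.mem_union, not_or] at hj
    have e := h' j hj.2
    rw [mul_inv_cancel, h j hj.1] at e
    simp only [map_inv, FreeGroup.lift_apply_of, FreeGroup.intValue_apply, toAdd_inv, toAdd_ofAdd]
    omega
  | mul x y hx hy =>
    obtain ⟨N, hN⟩ := hx
    obtain ⟨N', hN'⟩ := hy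
    refine ⟨N + N' + B, fun g => ?_⟩
    obtain ⟨T, hT, h⟩ := hN g
    obtain ⟨T', hT', h'⟩ := hN' g
    obtain ⟨U, hU, hu⟩ := hc (FreeGroup.lift g x) (FreeGroup.lift g y)
    refine ⟨T ∪ T' ∪ U, (Finset.card_union_le _ _).trans
      (by have := Finset.card_union_le T T'; omega), fun j hj => ?_⟩
    simp only [Finset.mem_union, not_or] at hj
    rw [map_mul, hu j hj.2, h j hj.1.1, h' j hj.1.2]
    simp [FreeGroup.intValue_apply]

end UniformDefect

namespace IntFreeProd

/-- The multiplicity of `n = j` minus that of `n = -j`. -/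
def signedIndicator (n j : ℤ) : ℤ :=
  (if n = j then 1 else 0) - (if n = -j then 1 else 0)

theorem signedIndicator_neg (n : ℤ) : signedIndicator (-n) = -signedIndicator n := by
  ext j
  have : -n = j ↔ n = -j := by omega
  simp [signedIndicator, this]

theorem signedIndicator_zero : signedIndicator 0 = 0 := by
  have := signedIndicator_neg 0
  rwa [neg_zero, self_eq_neg] at this

theorem signedIndicator_eq_zero {n j : ℤ} (h : j ≠ n) (h' : j ≠ -n) : signedIndicator n j = 0 := by
  rw [signedIndicator, if_neg (by omega), if_neg (by omega), sub_zero]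

/-- The signed indicator on the factor with index `false`, extended by zero to the other factor. -/
def syllableWeight (i : Bool) (n : Multiplicative ℤ) : ℤ → ℤ :=
  if i then 0 else signedIndicator n.toAdd

theorem syllableWeight_one (i : Bool) : syllableWeight i 1 = 0 := by
  simp [syllableWeight, signedIndicator_zero]

theorem syllableWeight_inv (i : Bool) (n : Multiplicative ℤ) :
    syllableWeight i n⁻¹ = -syllableWeight i n := by
  cases i <;> simp [syllableWeight, signedIndicator_neg]

/-- The number of syllables `j` minus the number of syllables `-j` in the factor with index
`false`. -/
def syllableCount (j : ℤ) (x : IntFreeProd) : ℤ :=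
  CoprodI.syllableSum syllableWeight x j

@[simp]
theorem syllableCount_one (j : ℤ) : syllableCount j 1 = 0 := by
  simp [syllableCount]

theorem syllableCount_mul (x y : IntFreeProd) :
    ∃ T : Finset ℤ, T.card ≤ 6 ∧
      ∀ j ∉ T, syllableCount j (x * y) = syllableCount j x + syllableCount j y := by
  rcases CoprodI.exists_syllableSum_mul syllableWeight_one syllableWeight_inv x y with
    h | ⟨i, s, t, h⟩
  · exact ⟨∅, by simp, fun j _ => congrFun h j⟩
  · refine ⟨{s.toAdd, -s.toAdd, t.toAdd, -t.toAdd, s.toAdd + t.toAdd, -(s.toAdd + t.toAdd)},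
      Finset.card_le_six, fun j hj => ?_⟩
    simp only [Finset.mem_insert, Finset.mem_singleton, not_or] at hj
    obtain ⟨h1, h2, h3, h4, h5, h6⟩ := hj
    have := congrFun h j
    rw [syllableCount, this]
    cases i
    · simp [syllableCount, syllableWeight, signedIndicator_eq_zero h1 h2,
        signedIndicator_eq_zero h3 h4, signedIndicator_eq_zero h5 h6]
    · simp [syllableCount, syllableWeight]

theorem syllableCount_gpow_false_mul (j n : ℤ) {x : IntFreeProd} (hx : headExp false x = 0) :
    syllableCount j (gpow false n * x) = signedIndicator n j + syllableCount j x :=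
  congrFun (CoprodI.syllableSum_of_mul syllableWeight_one (k := false)
    (Multiplicative.ofAdd n) (x := x) (by simpa [headExp] using hx)) j

theorem syllableCount_gpow_true_mul (j n : ℤ) {x : IntFreeProd} (hx : headExp true x = 0) :
    syllableCount j (gpow true n * x) = syllableCount j x :=
  (congrFun (CoprodI.syllableSum_of_mul syllableWeight_one (k := true)
    (Multiplicative.ofAdd n) (x := x) (by simpa [headExp] using hx)) j).trans (zero_add _)

theorem exists_syllableCount_eq_zero (x : IntFreeProd) :
    ∃ T : Finset ℤ, ∀ j ∉ T, syllableCount j x = 0 := by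
  induction x using gpow_induction with
  | one => exact ⟨∅, fun j _ => by simp⟩
  | gpow i n =>
    refine ⟨{n, -n}, fun j hj => ?_⟩
    simp only [Finset.mem_insert, Finset.mem_singleton, not_or] at hj
    rw [← mul_one (gpow i n)]
    cases i
    · rw [syllableCount_gpow_false_mul j n (headExp_one _), signedIndicator_eq_zero hj.1 hj.2]
      simp
    · rw [syllableCount_gpow_true_mul j n (headExp_one _)]
      simp
  | mul x y hx hy =>
    obtain ⟨T, hT⟩ := hx
    obtain ⟨T', hT'⟩ := hy
    obtain ⟨U, -, hU⟩ := syllableCount_mul x y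
    refine ⟨T ∪ T' ∪ U, fun j hj => ?_⟩
    simp only [Finset.mem_union, not_or] at hj
    rw [hU j hj.2, hT j hj.1.1, hT' j hj.1.2, add_zero]

/-- Conjugates of the generator of the factor `true` by distinct positive powers of the generator
of the factor `false`. -/
def conjGen (i : ℕ) : IntFreeProd :=
  gpow false (i + 1) * (gpow true 1 * gpow false (-(i + 1)))

theorem headExp_lift_conjGen_mul {c : IntFreeProd} (hc : headExp false c = 0) :
    ∀ l : List (ℕ × Bool), FreeGroup.IsReduced l → ∀ p ∈ l.head?,
      headExp false (FreeGroup.lift conjGen (FreeGroup.mk l) * c) = p.1 + 1 ∧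
      0 < (if p.2 then 1 else -1) * headExp true
        (gpow false (-(p.1 + 1)) * (FreeGroup.lift conjGen (FreeGroup.mk l) * c))
  | [], _, p, hp => by simp at hp
  | (i, ε) :: l, hl, p, hp => by
    obtain rfl : (i, ε) = p := by simpa using hp
    set z := FreeGroup.lift conjGen (FreeGroup.mk l) * c with hz
    have hsign : headExp true (gpow false (-(i + 1)) * z) = 0 ∨
        0 < (if ε then 1 else -1) * headExp true (gpow false (-(i + 1)) * z) := by
      cases l with
      | nil =>
        left
        refine headExp_eq_zero_of_ne (k := false) (by simp) ?_
        rw [headExp_gpow_mul]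
        simp only [hz, ← FreeGroup.one_eq_mk, map_one, one_mul, hc]
        omega
      | cons r l =>
        have ih := headExp_lift_conjGen_mul hc (r :: l) hl.tail r (by simp)
        rw [← hz] at ih
        by_cases hir : i = r.1
        · right
          have : ε = r.2 := (List.isChain_cons_cons.1 hl).1 hir
          rw [hir, this]
          exact ih.2
        · left
          refine headExp_eq_zero_of_ne (k := false) (by simp) ?_
          rw [headExp_gpow_mul, ih.1]
          omega
    have hprod : FreeGroup.lift conjGen (FreeGroup.mk ((i, ε) :: l)) * c =
        gpow false (i + 1) * (gpow true (if ε then 1 else -1) * (gpow false (-(i + 1)) * z)) := by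
      rw [hz, ← mul_assoc, ← mul_assoc, ← mul_assoc]
      cases ε <;> simp [conjGen, mul_assoc]
    have hpos : 0 < (if ε then 1 else -1) * headExp true
        (gpow true (if ε then 1 else -1) * (gpow false (-(i + 1)) * z)) := by
      rw [headExp_gpow_mul]
      cases ε
      · simp only [Bool.false_eq_true, if_false] at hsign ⊢
        omega
      · simp only [if_true] at hsign ⊢
        omega
    constructor
    · rw [hprod, headExp_gpow_mul, headExp_eq_zero_of_ne (k := true) (by simp), add_zero]
      intro h0
      rw [h0, mul_zero] at hpos
      exact hpos.false
    · rw [hprod, ← mul_assoc (gpow false _) (gpow false _), ← gpow_add]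
      simpa using hpos

theorem headExp_lift_conjGen_mul_ne_zero {w : FreeGroup ℕ} (hw : w ≠ 1) {c : IntFreeProd}
    (hc : headExp false c = 0) : headExp false (FreeGroup.lift conjGen w * c) ≠ 0 := by
  obtain ⟨p, hp⟩ : ∃ p, p ∈ w.toWord.head? := by
    cases h : w.toWord with
    | nil => exact absurd (FreeGroup.toWord_eq_nil_iff.1 h) hw
    | cons p l => exact ⟨p, rfl⟩
  have := (headExp_lift_conjGen_mul hc w.toWord FreeGroup.isReduced_toWord p hp).1
  rw [FreeGroup.mk_toWord] at this
  omega

/-- The product of the elements `a ^ n * b` for `n` in a list, where `a`, `b` are the standard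
generators. -/
def comb (l : List ℤ) : IntFreeProd :=
  (l.map fun n => gpow false n * gpow true 1).prod

@[simp]
theorem comb_nil : comb [] = 1 := rfl

@[simp]
theorem comb_cons (n : ℤ) (l : List ℤ) :
    comb (n :: l) = gpow false n * (gpow true 1 * comb l) := by
  simp [comb, mul_assoc]

theorem comb_append (l l' : List ℤ) : comb (l ++ l') = comb l * comb l' := by
  simp [comb]

theorem headExp_inv_comb {l : List ℤ} (hl : ∀ n ∈ l, 0 < n) : headExp false (comb l)⁻¹ = 0 := by
  induction l using List.reverseRecOn with
  | nil => simp
  | append_singleton l n ih =>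
    have hn : 0 < n := hl n (by simp)
    have := ih fun m hm => hl m (by simp [hm])
    rw [comb_append, comb_cons, comb_nil, mul_one]
    simp only [mul_inv_rev, inv_gpow, mul_assoc]
    exact headExp_gpow_mul_of_ne (by simp) (by simp)
      (headExp_gpow_mul_of_ne (by simp) (by omega) this)

theorem headExp_gpow_mul_comb_mul {l : List ℤ} (hl : ∀ n ∈ l, 0 < n) {z : IntFreeProd}
    (hz : headExp true z = 0) : headExp false (gpow true 1 * (comb l * z)) = 0 := by
  induction l with
  | nil => simpa using headExp_gpow_mul_of_ne (by simp) one_ne_zero hz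
  | cons n l ih =>
    have hn : 0 < n := hl n (by simp)
    have := ih fun m hm => hl m (by simp [hm])
    refine headExp_gpow_mul_of_ne (by simp) one_ne_zero ?_
    rw [comb_cons, mul_assoc, mul_assoc]
    exact headExp_gpow_mul_of_ne (by simp) hn.ne' this

theorem syllableCount_comb {l : List ℤ} (hl : ∀ n ∈ l, 0 < n) {j : ℤ} (hj : 0 < j) :
    syllableCount j (comb l) = l.count j := by
  induction l with
  | nil => simp
  | cons n l ih =>
    have hl' : ∀ m ∈ l, 0 < m := fun m hm => hl m (by simp [hm])
    have hn : 0 < n := hl n (by simp)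
    have h0 := headExp_gpow_mul_comb_mul hl' (z := 1) (headExp_one _)
    rw [mul_one] at h0
    have h1 : headExp true (comb l) = 0 := by
      cases l with
      | nil => simp
      | cons m l =>
        have hm : 0 < m := hl' m (by simp)
        have h2 := headExp_gpow_mul_comb_mul (l := l) (fun m hm => hl' m (by simp [hm]))
          (z := 1) (headExp_one _)
        rw [mul_one] at h2
        rw [comb_cons]
        exact headExp_gpow_mul_of_ne (by simp) hm.ne' h2
    rw [comb_cons, syllableCount_gpow_false_mul _ _ h0, syllableCount_gpow_true_mul _ _ h1, ih hl',
      List.count_cons, signedIndicator, if_neg (by omega : ¬n = -j)]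
    by_cases h : n = j <;> simp [h, add_comm]

/-- All the powers in a comb occurring in an element of a rational set can be lengthened. -/
theorem exists_pump_comb {R : Set IntFreeProd} {L : ℕ}
    (hL : ∀ (x y : IntFreeProd) (n : ℤ), L ≤ n → headExp false x⁻¹ = 0 → headExp false y = 0 →
      x * (gpow false n * y) ∈ R → ∃ n', n < n' ∧ n' < n + L ∧ x * (gpow false n' * y) ∈ R)
    {z : IntFreeProd} (hz : headExp true z = 0) (l l₀ : List ℤ) (hl₀ : ∀ n ∈ l₀, 0 < n)
    (hl : ∀ n ∈ l, 0 < n ∧ L ≤ n) (h : comb (l₀ ++ l) * z ∈ R) :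
    ∃ l', List.Forall₂ (fun n n' : ℤ => n < n' ∧ n' < n + L) l l' ∧ comb (l₀ ++ l') * z ∈ R := by
  induction l generalizing l₀ with
  | nil => exact ⟨[], .nil, h⟩
  | cons n l ih =>
    have hl' : ∀ m ∈ l, 0 < m ∧ L ≤ m := fun m hm => hl m (by simp [hm])
    have hn := hl n (by simp)
    rw [comb_append, comb_cons] at h
    simp only [mul_assoc] at h
    obtain ⟨n', h1, h2, h3⟩ := hL _ _ n hn.2 (headExp_inv_comb hl₀)
      (headExp_gpow_mul_comb_mul (fun m hm => (hl' m hm).1) hz) h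
    obtain ⟨l', hll, hmem⟩ := ih (l₀ ++ [n']) (by
        intro m hm
        rcases List.mem_append.1 hm with hm | hm
        · exact hl₀ m hm
        · rw [List.mem_singleton.1 hm]
          omega) hl' (by
        rw [comb_append, comb_append]
        simpa [mul_assoc] using h3)
    exact ⟨n' :: l', .cons ⟨h1, h2⟩ hll, by simpa using hmem⟩

theorem not_isRationalSubset_verbalSet {w : FreeGroup ℕ} (hw1 : w ≠ 1) {q : ℤ} (hq : ¬IsUnit q)
    (hwq : ∀ n, q ∣ w.intValue n) : ¬IsRationalSubset (verbalSet w IntFreeProd) := by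
  intro hR
  obtain ⟨L, hL0, hL⟩ := exists_pump hR false
  obtain ⟨N, hN⟩ := exists_card_lift_eq_intValue syllableCount_mul w
  set v := FreeGroup.lift conjGen w
  obtain ⟨S, hS⟩ := exists_syllableCount_eq_zero v
  set m := N + 18 + S.card + 1
  set l : List ℤ := (List.range m).map fun k : ℕ => ((k : ℤ) + 1) * L with hldef
  have hlL : ∀ n ∈ l, 0 < n ∧ (L : ℤ) ≤ n := by
    intro n hn
    obtain ⟨k, -, rfl⟩ := List.mem_map.1 hn
    constructor
    · positivity
    · nlinarith
  have hlpos : ∀ n ∈ l, 0 < n := fun n hn => (hlL n hn).1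
  have hinj : Function.Injective fun k : ℕ => ((k : ℤ) + 1) * L := by
    intro a b hab
    have := mul_right_cancel₀ (by omega : (L : ℤ) ≠ 0) hab
    omega
  set h := comb l
  have hz : headExp true (v * h⁻¹) = 0 := headExp_eq_zero_of_ne (k := false) (by simp)
    (headExp_lift_conjGen_mul_ne_zero hw1 (headExp_inv_comb hlpos))
  obtain ⟨l', hll, g, hg⟩ := exists_pump_comb hL hz l [] (by simp) hlL
    (by simpa using conj_mem_verbalSet ⟨conjGen, rfl⟩ h)
  rw [List.nil_append] at hg
  change FreeGroup.lift g w = _ at hg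
  have hl'pos : ∀ n ∈ l', 0 < n := by
    intro n hn
    obtain ⟨k, hk, rfl⟩ := List.mem_iff_getElem.1 hn
    have := (List.forall₂_iff_get.1 hll).2 k (by rw [hll.length_eq]; exact hk) hk
    have h1 := hlpos _ (List.get_mem l ⟨k, by rw [hll.length_eq]; exact hk⟩)
    simp only [List.get_eq_getElem] at this h1
    omega
  have hl'mul : ∀ k : ℕ, ((k : ℤ) + 1) * L ∉ l' := by
    intro k hk
    obtain ⟨i, hi, e⟩ := List.mem_iff_getElem.1 hk
    have := (List.forall₂_iff_get.1 hll).2 i (by rw [hll.length_eq]; exact hi) hi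
    simp only [List.get_eq_getElem, e, hldef, List.getElem_map, List.getElem_range] at this
    have h1 : (i : ℤ) + 1 < k + 1 := lt_of_mul_lt_mul_right this.1 (by positivity)
    have h2 : (k : ℤ) + 1 < i + 1 + 1 :=
      lt_of_mul_lt_mul_right (a := (L : ℤ)) (by linarith [this.2]) (by positivity)
    omega
  obtain ⟨T₀, hT₀, h₀⟩ := hN g
  obtain ⟨T₁, hT₁, h₁⟩ := syllableCount_mul (comb l') (v * h⁻¹)
  obtain ⟨T₂, hT₂, h₂⟩ := syllableCount_mul v h⁻¹
  obtain ⟨T₃, hT₃, h₃⟩ := syllableCount_mul h⁻¹ h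
  have hT : (T₀ ∪ T₁ ∪ T₂ ∪ T₃ ∪ S).card < ((Finset.range m).image fun k : ℕ => ((k : ℤ) + 1) * L).card := by
    rw [Finset.card_image_of_injective _ hinj, Finset.card_range]
    have e1 := Finset.card_union_le (T₀ ∪ T₁ ∪ T₂ ∪ T₃) S
    have e2 := Finset.card_union_le (T₀ ∪ T₁ ∪ T₂) T₃
    have e3 := Finset.card_union_le (T₀ ∪ T₁) T₂
    have e4 := Finset.card_union_le T₀ T₁
    omega
  obtain ⟨j, hj, hjT⟩ := Finset.exists_mem_notMem_of_card_lt_card hT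
  obtain ⟨k, hk, rfl⟩ := Finset.mem_image.1 hj
  simp only [Finset.mem_union, not_or] at hjT
  obtain ⟨⟨⟨⟨n₀, n₁⟩, n₂⟩, n₃⟩, nS⟩ := hjT
  set j := ((k : ℤ) + 1) * L
  have hjpos : 0 < j := by positivity
  have hjl : j ∈ l := List.mem_map.2 ⟨k, by simpa using hk, rfl⟩
  have hcount : l.count j = 1 :=
    List.count_eq_one_of_mem (List.nodup_range.map hinj) hjl
  have c₃ := h₃ j n₃
  rw [inv_mul_cancel, syllableCount_one, syllableCount_comb hlpos hjpos, hcount] at c₃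
  have c₀ := h₀ j n₀
  rw [hg, h₁ j n₁, h₂ j n₂, hS j nS, syllableCount_comb hl'pos hjpos,
    List.count_eq_zero.2 (hl'mul k)] at c₀
  have hdvd := hwq fun i => syllableCount j (g i)
  rw [← c₀] at hdvd
  refine hq (isUnit_of_dvd_unit hdvd ?_)
  have : ((0 : ℕ) : ℤ) + (0 + syllableCount j h⁻¹) = -1 := by push_cast at c₃ ⊢; omega
  rw [this]
  exact isUnit_one.neg

theorem closure_gpow : Subgroup.closure {gpow false 1, gpow true 1} = ⊤ := by
  rw [Subgroup.eq_top_iff']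
  intro x
  induction x using gpow_induction with
  | one => exact one_mem _
  | gpow i n =>
    have : gpow i n = gpow i 1 ^ n := by simp [gpow, ← map_zpow, ← ofAdd_zsmul]
    rw [this]
    refine zpow_mem (Subgroup.subset_closure ?_) n
    cases i <;> simp
  | mul x y hx hy => exact mul_mem hx hy

end IntFreeProd

section Quotients

theorem exists_surjective_int_of_infinite_abelianization {C : Type*} [Group C] (hC : Group.FG C)
    (hCab : Infinite (Abelianization C)) :
    ∃ f : C →* Multiplicative ℤ, Function.Surjective f := by
  have : Group.FG (Abelianization C) :=
    Group.fg_of_surjective (f := Abelianization.of) (QuotientGroup.mk'_surjective _)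
  obtain ⟨ι, κ, _, _, p, hp, e, ⟨φ⟩⟩ :=
    CommGroup.equiv_free_prod_prod_multiplicative_zmod (Abelianization C)
  rcases isEmpty_or_nonempty κ with hκ | ⟨⟨k⟩⟩
  · have (i : ι) : NeZero (p i ^ e i) := ⟨pow_ne_zero _ (hp i).ne_zero⟩
    have (i : ι) : Finite (Multiplicative (ZMod (p i ^ e i))) :=
      inferInstanceAs (Finite (ZMod (p i ^ e i)))
    exact absurd (Finite.of_equiv _ φ.symm.toEquiv) (not_finite_iff_infinite.2 hCab)
  · refine ⟨(Pi.evalMonoidHom (fun _ : κ => Multiplicative ℤ) k).comp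
      ((MonoidHom.fst _ _).comp (φ.toMonoidHom.comp Abelianization.of)), ?_⟩
    exact (Function.surjective_eval k).comp (Prod.fst_surjective.comp
      (φ.surjective.comp (QuotientGroup.mk'_surjective _)))

/-- The free product of two groups that map onto `ℤ` maps onto every group with two generators. -/
theorem exists_surjective_of_closure_pair {C D Q : Type*} [Group C] [Group D] [Group Q]
    (hC : ∃ f : C →* Multiplicative ℤ, Function.Surjective f)
    (hD : ∃ f : D →* Multiplicative ℤ, Function.Surjective f)
    {x y : Q} (hxy : Subgroup.closure {x, y} = ⊤) :
    ∃ φ : Coprod C D →* Q, Function.Surjective φ := by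
  obtain ⟨f, hf⟩ := hC
  obtain ⟨g, hg⟩ := hD
  obtain ⟨c, hc⟩ := hf (Multiplicative.ofAdd 1)
  obtain ⟨d, hd⟩ := hg (Multiplicative.ofAdd 1)
  refine ⟨Coprod.lift ((zpowersHom Q x).comp f) ((zpowersHom Q y).comp g), ?_⟩
  rw [← MonoidHom.range_eq_top, eq_top_iff, ← hxy, Subgroup.closure_le]
  rintro _ (rfl | rfl)
  · exact ⟨Coprod.inl c, by simp [hc]⟩
  · exact ⟨Coprod.inr d, by simp [hd]⟩

end Quotients

theorem mainTheorem7 {C : Type*} {D : Type*} [Group C] [Group D]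
    (hC : Group.FG C) (hD : Group.FG D)
    (hCab : Infinite (Abelianization C)) (hDab : Infinite (Abelianization D)) :
    (∀ w : FreeGroup ℕ, IsProperWord.{u, v} w →
      ¬ IsRationalSubset (verbalSet w (Monoid.Coprod C D))) ∧
    ∃ φ : Monoid.Coprod C D →* FreeGroup (Fin 2), Function.Surjective φ := by
  have hC' := exists_surjective_int_of_infinite_abelianization hC hCab
  have hD' := exists_surjective_int_of_infinite_abelianization hD hDab
  constructor
  · intro w hw hR
    obtain ⟨f, hf⟩ := exists_surjective_of_closure_pair hC' hD' IntFreeProd.closure_gpow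
    obtain ⟨q, hq, hwq⟩ := hw.exists_dvd_intValue
    have := hR.image f
    rw [verbalSet_image w hf] at this
    exact IntFreeProd.not_isRationalSubset_verbalSet hw.ne_one hq hwq this
  · refine exists_surjective_of_closure_pair hC' hD' (x := FreeGroup.of 0) (y := FreeGroup.of 1) ?_
    rw [← FreeGroup.closure_range_of]
    congr 1
    ext x
    simp [eq_comm]
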